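/- Let $q$ be a prime power, $m\ge 1$, and write $x^{[i]}=x^{q^i}$ for $x\in\mathbb F_{q^m}$, $i\in\mathbb Z$ (for $i<0$ this is the inverse Frobenius iterate); powers $[i]$ of vectors are taken coordinatewise, and for a code $C\subseteq\mathbb F_{q^m}^n$ put $C^{[i]}=\{c^{[i]}:c\in C\}$. Let $\mathcal C_{\rm pub}\subseteq\mathbb F_{q^m}^n$ be an $\mathbb F_{q^m}$-linear code of dimension $k$ (for instance a public code of Loidreau's scheme), $C=\mathcal C_{\rm pub}^\perp$ its dual, and let $\lambda\ge 2$ be an integer with $\lambda\le \frac{n}{n-k+1}$ and $2\lambda\le n-k$. Let $d=n-k-\lambda+1$. Let $\mathcal S$ be the set of all $(\mathbf h,\vec\beta)\in(\mathbb F_{q^m}^n)^\lambda\times\mathbb F_{q^m}^{\lambda-1}$, $\mathbf h=(\mathbf h_0,\dots,\mathbf h_{\lambda-1})$, $\vec\beta=(\beta_1,\dots,\beta_{\lambda-1})$, such that $$C=\Big\langle \mathbf h_0^{[i]}+\sum_{j=1}^{\lambda-1}\beta_j\mathbf h_j^{[i]},\ i=0,\dots,n-k-1\Big\rangle_{\mathbb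 F_{q^m}},$$ every $\mathbf h_j$ has rank $n$ (its coordinates span an $\mathbb F_q$-space of dimension $n$), and $1,\beta_1,\dots,\beta_{\lambda-1}$ are linearly independent over $\mathbb F_q$. Assume: 1. there is $(\mathbf h,\vec\beta)\in\mathcal S$ such that for all distinct $i_1,\dots,i_\lambda\in\{0,\dots,n-k-1\}$ the $\lambda\times\lambda$ matrix with rows $(1,\beta_1^{[i_a]},\dots,\beta_{\lambda-1}^{[i_a]})$, $a=1,\dots,\lambda$, has nonzero determinant; 2. $\dim_{\mathbb F_{q^m}}\big(C+C^{[1]}+\dots+C^{[\lambda]}\big)=\lambda(n-k)+\lambda$; 3. for the $\vec\beta$ of (1), no $A=(a_{i,j})_{i,j=0}^{\lambda-1}\in GL_\lambda(\mathbb F_q)$ with nontrivial class in $PGL_\lambda(\mathbb F_q)$ satisfies $\beta_j=\dfrac{a_{0,j}+\sum_{i=1}^{\lambda-1}a_{i,j}\beta_i}{a_{0,0}+\sum_{i=1}^{\lambda-1}a_{i,0}\beta_i}$ for all $j=1,\dots,\lambda-1$. Consider the following algorithm, applied to $C$: * $\mathcal S_0=C^{[0]}+C^{[1]}+\dots+C^{[\lambda-1]}$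 and $\mathcal A=\big(\bigcap_{i=0}^{d}\mathcal S_0^{[i]}\big)^{[-d]}$; * $\mathcal D_{\lambda-1}=\mathcal A^{[\lambda-2]}\cap C^{[\lambda-1-d]}$, $\ \mathcal B_0=\mathcal A+\mathcal D_{\lambda-1}^{[1-\lambda]}$, $\ \mathcal D_0=\mathcal B_0\cap C^{[-1]}$; * for $\ell=1,\dots,\lambda-2$: $\mathcal B_\ell=\mathcal A+\sum_{j=0}^{\ell-1}\mathcal D_j^{[\ell-j]}$, $\ \mathcal D_\ell=\mathcal B_\ell\cap C^{[-1]}$; * $\mathcal H=\sum_{j=0}^{\lambda-1}\mathcal D_j^{[2-j-\lambda]}$; for $i=0,\dots,n-k-1$ return $\mathcal A_i=\mathcal H\cap C^{[-i]}$. Then for every $(\mathbf h,\vec\beta)\in\mathcal S$ and every $i=0,\dots,n-k-1$, the returned space $\mathcal A_i$ is one-dimensional and $$\mathcal A_i=\Big\langle \mathbf h_0+\sum_{j=1}^{\lambda-1}\beta_j^{[-i]}\mathbf h_j\Big\rangle_{\mathbb F_{q^m}}.$$ In particular these spaces do not depend on the choice of $(\mathbf h,\vec\beta)\in\mathcal S$.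 -/

import Mathlib

open scoped BigOperators MatrixGroups

/-! Throughout, `F` is the finite field with `q` elements, `K` is the finite extension of `F` of
degree `m`, and `[i]` denotes the power `q ^ i` for an arbitrary integer `i`, that is, the
`i`-th power of the `q`-Frobenius automorphism of `K`. -/

namespace Loidreau

noncomputable section

section Frobenius

variable (F : Type*) {K : Type*} [Field F] [Fintype F] [Field K] [Finite K] [Algebra F K]

/-- `x ^ [i]`, where `x ^ [1] = x ^ q` and `i` is any integer. -/
def frob (i : ℤ) (x : K) : K :=
  ((FiniteField.frobeniusAlgEquivOfAlgebraic F K) ^ i : K ≃ₐ[F] K) x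

/-- The coordinatewise power `v ^ [i]` of a vector. -/
def frobVec {n : ℕ} (i : ℤ) (v : Fin n → K) : Fin n → K := fun t => frob F i (v t)

theorem frob_one (x : K) : frob F 1 x = x ^ Fintype.card F := by
  simp [frob]

theorem frob_frob_neg (i : ℤ) (x : K) : frob F i (frob F (-i) x) = x := by
  unfold frob
  rw [← AlgEquiv.mul_apply, ← zpow_add, add_neg_cancel, zpow_zero, AlgEquiv.one_apply]

/-- The Frobenius twist `C ^ [i] = {c ^ [i] : c ∈ C}` of a code. -/
def twist {n : ℕ} (i : ℤ) (C : Submodule K (Fin n → K)) : Submodule K (Fin n → K) where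
  carrier := {v | ∃ c ∈ C, v = frobVec F i c}
  add_mem' := by
    rintro _ _ ⟨c, hc, rfl⟩ ⟨c', hc', rfl⟩
    exact ⟨c + c', C.add_mem hc hc', by funext t; simp [frobVec, frob]⟩
  zero_mem' := ⟨0, C.zero_mem, by funext t; simp [frobVec, frob]⟩
  smul_mem' := by
    rintro a _ ⟨c, hc, rfl⟩
    refine ⟨frob F (-i) a • c, C.smul_mem _ hc, ?_⟩
    funext t
    have h : frob F i (frob F (-i) a * c t) =
        frob F i (frob F (-i) a) * frob F i (c t) := by simp [frob]
    simp [frobVec, h, frob_frob_neg]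

/-- The rank of a vector: the dimension over `F` of the span of its coordinates. -/
def vecRank {n : ℕ} (v : Fin n → K) : ℕ :=
  Module.finrank F (Submodule.span F (Set.range v))

end Frobenius

/-- The dual code of `C` for the standard bilinear form. -/
def dualCode {K : Type*} [Field K] {n : ℕ} (C : Submodule K (Fin n → K)) :
    Submodule K (Fin n → K) where
  carrier := {x | ∀ c ∈ C, ∑ t, c t * x t = 0}
  add_mem' := by
    intro x y hx hy c hc
    simp [mul_add, Finset.sum_add_distrib, hx c hc, hy c hc]
  zero_mem' := by intro c _; simp
  smul_mem' := by
    intro a x hx c hc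
    have h : ∑ t, c t * (a • x) t = a * ∑ t, c t * x t := by
      rw [Finset.mul_sum]
      exact Finset.sum_congr rfl fun t _ => by simp only [Pi.smul_apply, smul_eq_mul]; ring
    rw [h, hx c hc, mul_zero]

section Solutions

variable (F : Type*) {K : Type*} [Field F] [Fintype F] [Field K] [Finite K] [Algebra F K]

/-- The tuple `(1, β_1, …, β_{λ-1})`, with `λ = s + 1`. The entry `β_j` is `β ⟨j - 1, _⟩`. -/
def withOne {s : ℕ} (β : Fin s → K) : Fin (s + 1) → K := Fin.cons 1 β

/-- The vector `y^{[u,j]} = h_0^[j] + ∑_{i=1}^{λ-1} β_i^[u] h_i^[j]`. -/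
def yVec {n s : ℕ} (h : Fin (s + 1) → Fin n → K) (β : Fin s → K) (u j : ℤ) : Fin n → K :=
  frobVec F j (h 0) + ∑ i : Fin s, frob F u (β i) • frobVec F j (h i.succ)

/-- The solution set of a code `D` of length `n` (in the application, `D` is the dual of the public
code, of dimension `r = n - k`), for the parameter `λ = s + 1`. -/
def solutionSet {n : ℕ} (s r : ℕ) (D : Submodule K (Fin n → K)) :
    Set ((Fin (s + 1) → Fin n → K) × (Fin s → K)) :=
  {p | D = Submodule.span K {v | ∃ i : ℕ, i < r ∧ v = yVec F p.1 p.2 0 i} ∧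
    (∀ j, vecRank F (p.1 j) = n) ∧
    Module.finrank F (Submodule.span F (Set.range (withOne p.2))) = s + 1}

/-- The `λ × λ` matrix whose row of index `a` is `(1, β_1^[i_a], …, β_{λ-1}^[i_a])`. -/
def mooreMatrix {s : ℕ} (β : Fin s → K) (i : Fin (s + 1) → ℕ) :
    Matrix (Fin (s + 1)) (Fin (s + 1)) K :=
  Matrix.of fun a b => frob F (i a) (withOne β b)

/-- All the determinants `det (1, β_1^[i_a], …, β_{λ-1}^[i_a])_a` with distinct exponents
`i_a ∈ {0, …, r - 1}` are nonzero. -/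
def MooreNondegenerate {s : ℕ} (r : ℕ) (β : Fin s → K) : Prop :=
  ∀ i : Fin (s + 1) → ℕ, Function.Injective i → (∀ a, i a < r) →
    (mooreMatrix F β i).det ≠ 0

/-- The projective action of an invertible matrix over `F` on `(β_1, …, β_{λ-1})`:
`β_j ↦ (a_{0,j} + ∑ a_{i,j} β_i) / (a_{0,0} + ∑ a_{i,0} β_i)`. -/
def projAction {s : ℕ} (A : GL (Fin (s + 1)) F) (β : Fin s → K) : Fin s → K := fun j =>
  (algebraMap F K (A.val 0 j.succ) + ∑ i : Fin s, algebraMap F K (A.val i.succ j.succ) * β i) /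
  (algebraMap F K (A.val 0 0) + ∑ i : Fin s, algebraMap F K (A.val i.succ 0) * β i)

/-- Only the class of the identity in the projective linear group over `F` fixes `β`. -/
def TrivialStabilizer {s : ℕ} (β : Fin s → K) : Prop :=
  ∀ A : GL (Fin (s + 1)) F, projAction F A β = β →
    (Matrix.ProjGenLinGroup.mk A : Matrix.ProjGenLinGroup (Fin (s + 1)) F) = 1

end Solutions

/-! The algorithm that recovers the one-dimensional spaces. Its inputs are the code `D` (the dual
of the public code), of length `n`, the dimension `k` of the public code, and
`lam`, which stands for `λ`. -/

section Algorithm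

variable (F : Type*) {K : Type*} [Field F] [Fintype F] [Field K] [Finite K] [Algebra F K]
variable {n : ℕ} (k lam : ℕ) (D : Submodule K (Fin n → K))

/-- `S_0 = D^[0] + D^[1] + ⋯ + D^[λ-1]`. -/
def algS : Submodule K (Fin n → K) :=
  ⨆ i ∈ Finset.range lam, twist F (i : ℤ) D

/-- `d = n - k - λ + 1`. -/
def algd (n k lam : ℕ) : ℕ := n - k - lam + 1

/-- `A = (S_0^[0] ∩ S_0^[1] ∩ ⋯ ∩ S_0^[d])^[-d]`. -/
def algA : Submodule K (Fin n → K) :=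
  twist F (-(algd n k lam : ℤ))
    (⨅ i ∈ Finset.range (algd n k lam + 1), twist F (i : ℤ) (algS F lam D))

/-- `D_{λ-1} = A^[λ-2] ∩ D^[λ-1-d]`. -/
def algDLast : Submodule K (Fin n → K) :=
  twist F ((lam : ℤ) - 2) (algA F k lam D) ⊓ twist F ((lam : ℤ) - 1 - algd n k lam) D

/-- `B_0 = A + D_{λ-1}^[1-λ]`. -/
def algBZero : Submodule K (Fin n → K) :=
  algA F k lam D ⊔ twist F (1 - (lam : ℤ)) (algDLast F k lam D)

/-- The loop: `D_0 = B_0 ∩ D^[-1]`, and for `ℓ ≥ 1`, `D_ℓ = B_ℓ ∩ D^[-1]` with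
`B_ℓ = A + ∑_{j=0}^{ℓ-1} D_j^[ℓ-j]`. Only the indices `ℓ ≤ λ - 2` are used. -/
def algD (l : ℕ) : Submodule K (Fin n → K) :=
  (if l = 0 then algBZero F k lam D
    else algA F k lam D ⊔ ⨆ j : Fin l, twist F ((l : ℤ) - (j : ℕ)) (algD j)) ⊓
  twist F (-1) D
termination_by l
decreasing_by exact j.isLt

/-- `H = ∑_{j=0}^{λ-1} D_j^[2-j-λ]`. -/
def algH : Submodule K (Fin n → K) :=
  (⨆ j ∈ Finset.range (lam - 1), twist F (2 - (j : ℤ) - lam) (algD F k lam D j)) ⊔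
    twist F (2 - ((lam : ℤ) - 1) - lam) (algDLast F k lam D)

/-- The output `A_i = H ∩ D^[-i]`. -/
def algOutput (i : ℕ) : Submodule K (Fin n → K) :=
  algH F k lam D ⊓ twist F (-(i : ℤ)) D

end Algorithm

end

end Loidreau

namespace Loidreau

noncomputable section

/-! ### Frobenius twists act on the lattice of codes -/

section Twist

variable (F : Type*) {K : Type*} [Field F] [Fintype F] [Field K] [Finite K] [Algebra F K]

/-! Write `c = (1, β)`, `λ = s + 1`, `r = n - k`, and place the vector `∑ c_b^[t] h_b^[j]` in the
cell (column `j`, row `t`) of a grid. Then `D^[t]` is spanned by the cells of row `t` in columns `t,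
…, t + r - 1`, and twisting by `i` moves every cell by `(i, i)`. Assumption (2) says that `D + ⋯ +
D^[λ]` has the largest dimension the grid allows. Hence its columns are independent, and any `λ`
consecutive powers of `c` form a basis of `K^λ` (`generic_of_finrank`). Sums and intersections can
then be computed column by column (`ofColumns_inf`), each column being spanned by an interval of
powers of `c`.

The algorithm moves cells. Column `j` of `A` has rows `0..j` for `j < s` and rows `j-r+1..2s-r` for
`j ≥ s`. Condition (1) makes any `λ` powers of `c` with exponents in a window of length `r` a basis,
so a row meets a non-full column only in the cells visibly there (`PowersSpan.notMem_powSpan`). Thus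
`D_{λ-1}` is the cell `(2s-1, 2s-r)`; `B_l` is `A` with column `s-1+l` filled (`Generic.le_algB`);
and `D_l`, its intersection with row `-1`, is the cell `(s-1+l, -1)`. Moving these `λ` cells to
column `0` fills that column, so `H` is the span of the `h_b`, and `H ∩ D^[-i]` is the cell `(0,
-i)`.

Another solution need not satisfy (1), but (2) depends only on the code. Each cell of the other
solution still lies in the space computed by the algorithm, whose dimension is known from the first
solution, so comparing dimensions gives equality (`Generic.linesBelow_of_generic`). -/

theorem frob_add_exp (i j : ℤ) (x : K) : frob F i (frob F j x) = frob F (i + j) x := by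
  unfold frob
  rw [← AlgEquiv.mul_apply, ← zpow_add]

theorem frob_zero_exp (x : K) : frob F 0 x = x := by simp [frob]

theorem frobVec_frobVec {n : ℕ} (i j : ℤ) (v : Fin n → K) :
    frobVec F i (frobVec F j v) = frobVec F (i + j) v := by
  funext t; simp [frobVec, frob_add_exp]

theorem frobVec_zero_exp {n : ℕ} (v : Fin n → K) : frobVec F 0 v = v := by
  funext t; simp [frobVec, frob_zero_exp]

theorem frobVec_smul {n : ℕ} (i : ℤ) (a : K) (v : Fin n → K) :
    frobVec F i (a • v) = frob F i a • frobVec F i v := by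
  funext t; simp [frobVec, frob]

theorem frobVec_zero {n : ℕ} (i : ℤ) : frobVec F i (0 : Fin n → K) = 0 := by
  funext t; simp [frobVec, frob]

theorem frobVec_sum {n : ℕ} {ι : Type*} (S : Finset ι) (i : ℤ) (v : ι → Fin n → K) :
    frobVec F i (∑ a ∈ S, v a) = ∑ a ∈ S, frobVec F i (v a) := by
  funext t; simp [frobVec, frob]

theorem frobVec_eq_zero {n : ℕ} {i : ℤ} {v : Fin n → K} (h : frobVec F i v = 0) : v = 0 := by
  rw [← frobVec_zero_exp F v, ← neg_add_cancel i, ← frobVec_frobVec, h, frobVec_zero]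

theorem mem_twist {n : ℕ} {i : ℤ} {C : Submodule K (Fin n → K)} {v : Fin n → K} :
    v ∈ twist F i C ↔ ∃ c ∈ C, v = frobVec F i c := Iff.rfl

theorem twist_mono {n : ℕ} (i : ℤ) {C C' : Submodule K (Fin n → K)} (h : C ≤ C') :
    twist F i C ≤ twist F i C' := by
  rintro _ ⟨c, hc, rfl⟩
  exact ⟨c, h hc, rfl⟩

theorem twist_twist {n : ℕ} (i j : ℤ) (C : Submodule K (Fin n → K)) :
    twist F i (twist F j C) = twist F (i + j) C := by
  ext v
  constructor
  · rintro ⟨_, ⟨c, hc, rfl⟩, rfl⟩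
    exact ⟨c, hc, frobVec_frobVec F i j c⟩
  · rintro ⟨c, hc, rfl⟩
    exact ⟨_, ⟨c, hc, rfl⟩, (frobVec_frobVec F i j c).symm⟩

theorem twist_zero {n : ℕ} (C : Submodule K (Fin n → K)) : twist F 0 C = C := by
  ext v
  simp [mem_twist, frobVec_zero_exp]

/-- Twisting, as an automorphism of the lattice of codes. -/
def twistIso (n : ℕ) (i : ℤ) : Submodule K (Fin n → K) ≃o Submodule K (Fin n → K) where
  toFun := twist F i
  invFun := twist F (-i)
  left_inv C := by rw [twist_twist, neg_add_cancel, twist_zero]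
  right_inv C := by rw [twist_twist, add_neg_cancel, twist_zero]
  map_rel_iff' := by
    intro C C'
    refine ⟨fun h => ?_, twist_mono F i⟩
    have := twist_mono F (-i) h
    simpa [twist_twist, twist_zero] using this

theorem twist_inf {n : ℕ} (i : ℤ) (C C' : Submodule K (Fin n → K)) :
    twist F i (C ⊓ C') = twist F i C ⊓ twist F i C' := (twistIso F n i).map_inf C C'

theorem twist_iSup {n : ℕ} {ι : Sort*} (i : ℤ) (C : ι → Submodule K (Fin n → K)) :
    twist F i (⨆ a, C a) = ⨆ a, twist F i (C a) := (twistIso F n i).map_iSup C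

theorem twist_top {n : ℕ} (i : ℤ) : twist F i (⊤ : Submodule K (Fin n → K)) = ⊤ :=
  (twistIso F n i).map_top

theorem twist_bot {n : ℕ} (i : ℤ) : twist F i (⊥ : Submodule K (Fin n → K)) = ⊥ :=
  (twistIso F n i).map_bot

theorem twist_span {n : ℕ} (i : ℤ) (S : Set (Fin n → K)) :
    twist F i (Submodule.span K S) = Submodule.span K (frobVec F i '' S) := by
  apply le_antisymm
  · have : Submodule.span K S ≤ twist F (-i) (Submodule.span K (frobVec F i '' S)) := by
      rw [Submodule.span_le]
      intro v hv
      refine ⟨frobVec F i v, Submodule.subset_span ⟨v, hv, rfl⟩, ?_⟩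
      rw [frobVec_frobVec, neg_add_cancel, frobVec_zero_exp]
    simpa [twist_twist, twist_zero] using twist_mono F i this
  · rw [Submodule.span_le]
    rintro _ ⟨v, hv, rfl⟩
    exact ⟨v, Submodule.subset_span hv, rfl⟩

end Twist

/-! ### Column decompositions and their independence -/

section Columns

theorem finrank_pi_submodule {K V : Type*} [Field K] [AddCommGroup V] [Module K V]
    [FiniteDimensional K V] (X : ℤ → Submodule K V) (S : Finset ℤ) :
    Module.finrank K ((j : S) → X j) = ∑ j ∈ S, Module.finrank K (X j) := by
  rw [Module.finrank_pi_fintype]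
  exact Finset.sum_coe_sort S fun j => Module.finrank K (X j)
variable (F : Type*) {K : Type*} [Field F] [Fintype F] [Field K] [Finite K] [Algebra F K]
variable {n s : ℕ}

/-- The linear map `v ↦ ∑ v_b h_b^[j]`. -/
def colMap (h : Fin (s + 1) → Fin n → K) (j : ℤ) : (Fin (s + 1) → K) →ₗ[K] (Fin n → K) :=
  Fintype.linearCombination K fun b => frobVec F j (h b)

theorem colMap_apply (h : Fin (s + 1) → Fin n → K) (j : ℤ) (v : Fin (s + 1) → K) :
    colMap F h j v = ∑ b, v b • frobVec F j (h b) := rfl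

theorem frobVec_colMap (h : Fin (s + 1) → Fin n → K) (i j : ℤ) (v : Fin (s + 1) → K) :
    frobVec F i (colMap F h j v) = colMap F h (j + i) (frobVec F i v) := by
  rw [colMap_apply, colMap_apply, frobVec_sum]
  refine Finset.sum_congr rfl fun b _ => ?_
  rw [frobVec_smul, frobVec_frobVec, add_comm]
  rfl

theorem yVec_eq_colMap (h : Fin (s + 1) → Fin n → K) (β : Fin s → K) (u j : ℤ) :
    yVec F h β u j = colMap F h j (frobVec F u (withOne β)) := by
  rw [colMap_apply, Fin.sum_univ_succ]
  simp [yVec, frobVec, withOne, frob]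

/-- The code with column `X j` in degree `j`. -/
def ofColumns (h : Fin (s + 1) → Fin n → K) (X : ℤ → Submodule K (Fin (s + 1) → K)) :
    Submodule K (Fin n → K) :=
  ⨆ j : ℤ, (X j).map (colMap F h j)

variable (h : Fin (s + 1) → Fin n → K)

theorem colMap_mem_ofColumns {X : ℤ → Submodule K (Fin (s + 1) → K)} {j : ℤ}
    {v : Fin (s + 1) → K} (hv : v ∈ X j) : colMap F h j v ∈ ofColumns F h X :=
  Submodule.mem_iSup_of_mem j ⟨v, hv, rfl⟩

theorem ofColumns_mono {X Y : ℤ → Submodule K (Fin (s + 1) → K)} (hXY : ∀ j, X j ≤ Y j) :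
    ofColumns F h X ≤ ofColumns F h Y :=
  iSup_mono fun j => Submodule.map_mono (hXY j)

theorem ofColumns_le {X : ℤ → Submodule K (Fin (s + 1) → K)} {C : Submodule K (Fin n → K)}
    (hX : ∀ j, ∀ v ∈ X j, colMap F h j v ∈ C) : ofColumns F h X ≤ C :=
  iSup_le fun j => by
    rintro _ ⟨v, hv, rfl⟩
    exact hX j v hv

theorem ofColumns_iSup {ι : Sort*} (X : ι → ℤ → Submodule K (Fin (s + 1) → K)) :
    ofColumns F h (fun j => ⨆ a, X a j) = ⨆ a, ofColumns F h (X a) := by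
  unfold ofColumns
  simp_rw [Submodule.map_iSup]
  exact iSup_comm

theorem twist_map_colMap (i j : ℤ) (X : Submodule K (Fin (s + 1) → K)) :
    twist F i (X.map (colMap F h j)) = (twist F i X).map (colMap F h (j + i)) := by
  ext v
  constructor
  · rintro ⟨_, ⟨x, hx, rfl⟩, rfl⟩
    exact ⟨frobVec F i x, ⟨x, hx, rfl⟩, (frobVec_colMap F h i j x).symm⟩
  · rintro ⟨_, ⟨x, hx, rfl⟩, rfl⟩
    exact ⟨_, ⟨x, hx, rfl⟩, (frobVec_colMap F h i j x).symm⟩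

theorem twist_ofColumns (i : ℤ) (X : ℤ → Submodule K (Fin (s + 1) → K)) :
    twist F i (ofColumns F h X) = ofColumns F h fun j => twist F i (X (j - i)) := by
  unfold ofColumns
  rw [twist_iSup]
  simp_rw [twist_map_colMap]
  refine (Equiv.addRight i).iSup_congr fun j => ?_
  simp

/-- The columns of `U` contribute independently. -/
def ColumnsIndep (U : ℤ → Submodule K (Fin (s + 1) → K)) : Prop :=
  ∀ (S : Finset ℤ) (x : ℤ → Fin (s + 1) → K), (∀ j, x j ∈ U j) →
    ∑ j ∈ S, colMap F h j (x j) = 0 → ∀ j ∈ S, x j = 0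

variable {F h}

theorem ColumnsIndep.twist {U : ℤ → Submodule K (Fin (s + 1) → K)} (hU : ColumnsIndep F h U)
    (i : ℤ) : ColumnsIndep F h fun j => twist F i (U (j - i)) := by
  intro S x hx hsum j hj
  have h1 := hU (S.map (Equiv.subRight i).toEmbedding) (fun j => frobVec F (-i) (x (j + i)))
    (fun j => by
      obtain ⟨c, hc, hxc⟩ := hx (j + i)
      simp only [add_sub_cancel_right] at hc
      rwa [hxc, frobVec_frobVec, neg_add_cancel, frobVec_zero_exp])
    (by
      rw [Finset.sum_map, ← frobVec_zero F (-i), ← hsum, frobVec_sum]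
      refine Finset.sum_congr rfl fun j _ => ?_
      rw [frobVec_colMap]
      simp [sub_eq_add_neg])
    (j - i) (by simpa using hj)
  simp only [sub_add_cancel] at h1
  exact frobVec_eq_zero F h1

theorem mem_ofColumns {X : ℤ → Submodule K (Fin (s + 1) → K)} {v : Fin n → K}
    (hv : v ∈ ofColumns F h X) : ∃ (S : Finset ℤ) (x : ℤ → Fin (s + 1) → K),
      (∀ j, x j ∈ X j) ∧ (∀ j ∉ S, x j = 0) ∧ v = ∑ j ∈ S, colMap F h j (x j) := by
  classical
  obtain ⟨f, hf, hfv⟩ := (Submodule.mem_iSup_iff_exists_finsupp _ _).1 hv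
  choose x hx hxf using hf
  refine ⟨f.support, fun j => if j ∈ f.support then x j else 0, fun j => ?_, fun j hj => ?_, ?_⟩
  · dsimp only
    split_ifs
    exacts [hx j, zero_mem _]
  · simp only [hj, if_false]
  · rw [← hfv, Finsupp.sum]
    refine Finset.sum_congr rfl fun j hj => ?_
    simp only [hj, if_true, hxf]

/-- A common vector has two column decompositions. Their difference lies in the independent family
`U`, so they agree term by term. -/
theorem ofColumns_inf {U X Y : ℤ → Submodule K (Fin (s + 1) → K)} (hU : ColumnsIndep F h U)
    (hX : ∀ j, X j ≤ U j) (hY : ∀ j, Y j ≤ U j) :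
    ofColumns F h X ⊓ ofColumns F h Y = ofColumns F h fun j => X j ⊓ Y j := by
  classical
  apply le_antisymm
  · rintro v ⟨hvX, hvY⟩
    obtain ⟨S, x, hx, hx0, hxv⟩ := mem_ofColumns hvX
    obtain ⟨T, y, hy, hy0, hyv⟩ := mem_ofColumns hvY
    have hxv' : v = ∑ j ∈ S ∪ T, colMap F h j (x j) := by
      rw [hxv]
      refine Finset.sum_subset Finset.subset_union_left fun j _ hj => ?_
      rw [hx0 j hj, map_zero]
    have hyv' : v = ∑ j ∈ S ∪ T, colMap F h j (y j) := by
      rw [hyv]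
      refine Finset.sum_subset Finset.subset_union_right fun j _ hj => ?_
      rw [hy0 j hj, map_zero]
    have key := hU (S ∪ T) (fun j => x j - y j)
      (fun j => sub_mem (hX j (hx j)) (hY j (hy j)))
      (by simp only [map_sub, Finset.sum_sub_distrib]; rw [← hxv', ← hyv', sub_self])
    rw [hxv']
    refine Submodule.sum_mem _ fun j hj => colMap_mem_ofColumns F h ⟨hx j, ?_⟩
    rw [sub_eq_zero.1 (key j hj)]
    exact hy j
  · exact le_inf (ofColumns_mono F h fun j => inf_le_left)
      (ofColumns_mono F h fun j => inf_le_right)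

variable (F h) in
/-- The sum map of the columns indexed by `S`. -/
def columnsSum (X : ℤ → Submodule K (Fin (s + 1) → K)) (S : Finset ℤ) :
    ((j : S) → X j) →ₗ[K] (Fin n → K) :=
  ∑ j : S, (colMap F h j ∘ₗ (X j).subtype) ∘ₗ LinearMap.proj j

theorem columnsSum_apply (X : ℤ → Submodule K (Fin (s + 1) → K)) (S : Finset ℤ)
    (x : (j : S) → X j) : columnsSum F h X S x = ∑ j : S, colMap F h j (x j) := by
  simp [columnsSum]

theorem range_columnsSum {X : ℤ → Submodule K (Fin (s + 1) → K)} {S : Finset ℤ}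
    (hS : ∀ j ∉ S, X j = ⊥) : LinearMap.range (columnsSum F h X S) = ofColumns F h X := by
  classical
  apply le_antisymm
  · rintro _ ⟨x, rfl⟩
    rw [columnsSum_apply]
    exact Submodule.sum_mem _ fun j _ => colMap_mem_ofColumns F h (x j).2
  · refine ofColumns_le F h fun j v hv => ?_
    by_cases hj : j ∈ S
    · refine ⟨Pi.single ⟨j, hj⟩ ⟨v, hv⟩, ?_⟩
      rw [columnsSum_apply, Finset.sum_eq_single ⟨j, hj⟩]
      · simp
      · intro i _ hi
        simp [Pi.single_eq_of_ne hi]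
      · simp
    · rw [hS j hj, Submodule.mem_bot] at hv
      rw [hv, map_zero]
      exact zero_mem _

theorem finrank_ofColumns {U X : ℤ → Submodule K (Fin (s + 1) → K)} (hU : ColumnsIndep F h U)
    (hX : ∀ j, X j ≤ U j) {S : Finset ℤ} (hS : ∀ j ∉ S, X j = ⊥) :
    Module.finrank K (ofColumns F h X) = ∑ j ∈ S, Module.finrank K (X j) := by
  classical
  rw [← range_columnsSum hS, LinearMap.finrank_range_of_inj, finrank_pi_submodule]
  rw [injective_iff_map_eq_zero]
  intro x hx
  rw [columnsSum_apply] at hx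
  have key := hU S (fun j => if hj : j ∈ S then x ⟨j, hj⟩ else 0)
    (fun j => by
      dsimp only
      split_ifs
      exacts [hX j (Subtype.prop _), zero_mem _])
    (by
      rw [← hx, ← Finset.sum_coe_sort S]
      refine Finset.sum_congr rfl fun j _ => ?_
      simp)
  funext j
  simpa using key j j.2

/-- The product of the columns maps onto the code, so by rank–nullity the dimension bound kills the
kernel. -/
theorem columnsIndep_of_sum_le {U : ℤ → Submodule K (Fin (s + 1) → K)} {S : Finset ℤ}
    (hS : ∀ j ∉ S, U j = ⊥)
    (hle : ∑ j ∈ S, Module.finrank K (U j) ≤ Module.finrank K (ofColumns F h U)) :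
    ColumnsIndep F h U := by
  classical
  have hinj : LinearMap.ker (columnsSum F h U S) = ⊥ := by
    have h1 := LinearMap.finrank_range_add_finrank_ker (columnsSum F h U S)
    rw [range_columnsSum hS, finrank_pi_submodule] at h1
    exact Submodule.finrank_eq_zero.1 (by omega)
  intro T x hx hsum j hj
  by_cases hjS : j ∈ S
  swap
  · simpa [hS j hjS] using hx j
  let x' : (j : S) → U j := fun j => if (j : ℤ) ∈ T then ⟨x j, hx j⟩ else 0
  have hx' : x' ∈ LinearMap.ker (columnsSum F h U S) := by
    rw [LinearMap.mem_ker, columnsSum_apply, ← hsum]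
    have h1 : ∑ j : S, colMap F h j (x' j) =
        ∑ j ∈ S, if j ∈ T then colMap F h j (x j) else 0 := by
      rw [← Finset.sum_coe_sort S]
      refine Finset.sum_congr rfl fun j _ => ?_
      by_cases hjT : (j : ℤ) ∈ T <;> simp [x', hjT]
    rw [h1, Finset.sum_ite_mem, Finset.inter_comm]
    refine Finset.sum_subset (f := fun i => colMap F h i (x i)) Finset.inter_subset_left
      fun i hi hiS => ?_
    have : i ∉ S := fun h' => hiS (Finset.mem_inter.2 ⟨hi, h'⟩)
    have h0 := hx i
    rw [hS i this, Submodule.mem_bot] at h0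
    rw [h0, map_zero]
  rw [hinj, Submodule.mem_bot] at hx'
  have := congrFun hx' ⟨j, hjS⟩
  simpa [x', hj] using this

end Columns

/-- Column `j` of `D + ⋯ + D^[λ]` has at most the dimension written here; the total is the dimension
required by assumption (2). -/
theorem sum_min_eq (s r : ℕ) (hr : s + 1 ≤ r) :
    ∑ j ∈ Finset.range (r + s + 1), min (s + 1) (min (s + 1) j + 1 - (j + 1 - r)) =
      (s + 1) * r + (s + 1) := by
  obtain ⟨e, rfl⟩ := Nat.exists_eq_add_of_le hr
  have h1 : s + 1 + e + s + 1 = (s + 1) + e + (s + 1) := by ring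
  rw [h1, Finset.sum_range_add, Finset.sum_range_add]
  have h2 : ∑ x ∈ Finset.range e, min (s + 1) (min (s + 1) (s + 1 + x) + 1 -
      (s + 1 + x + 1 - (s + 1 + e))) = ∑ x ∈ Finset.range e, (s + 1) :=
    Finset.sum_congr rfl fun x hx => by
      have := Finset.mem_range.1 hx
      omega
  -- Pair column `x ≤ s` with column `r + x`: their bounds `x + 1` and `s + 1 - x` add up to `s +
  -- 2`.
  rw [h2, add_right_comm, ← Finset.sum_add_distrib]
  have h3 : ∑ x ∈ Finset.range (s + 1), (min (s + 1) (min (s + 1) x + 1 - (x + 1 - (s + 1 + e))) +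
      min (s + 1) (min (s + 1) (s + 1 + e + x) + 1 - (s + 1 + e + x + 1 - (s + 1 + e)))) =
      ∑ x ∈ Finset.range (s + 1), (s + 2) :=
    Finset.sum_congr rfl fun x hx => by
      have := Finset.mem_range.1 hx
      omega
  rw [h3]
  simp only [Finset.sum_const, Finset.card_range, smul_eq_mul]
  ring

/-! ### Spans of consecutive Frobenius powers -/

section PowSpan

variable (F : Type*) {K : Type*} [Field F] [Fintype F] [Field K] [Finite K] [Algebra F K]
variable {s : ℕ}

/-- The span of the powers `c^[t]` for `a ≤ t ≤ b`. -/
def powSpan (c : Fin (s + 1) → K) (a b : ℤ) : Submodule K (Fin (s + 1) → K) :=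
  Submodule.span K ((fun t : ℤ => frobVec F t c) '' Set.Icc a b)

variable {c : Fin (s + 1) → K}

theorem frobVec_mem_powSpan {a b t : ℤ} (ha : a ≤ t) (hb : t ≤ b) :
    frobVec F t c ∈ powSpan F c a b :=
  Submodule.subset_span ⟨t, ⟨ha, hb⟩, rfl⟩

theorem powSpan_le {a b : ℤ} {X : Submodule K (Fin (s + 1) → K)}
    (hX : ∀ t, a ≤ t → t ≤ b → frobVec F t c ∈ X) : powSpan F c a b ≤ X := by
  rw [powSpan, Submodule.span_le]
  rintro _ ⟨t, ht, rfl⟩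
  exact hX t ht.1 ht.2

theorem powSpan_mono {a b a' b' : ℤ} (ha : a' ≤ a) (hb : b ≤ b') :
    powSpan F c a b ≤ powSpan F c a' b' :=
  powSpan_le F fun _ h1 h2 => frobVec_mem_powSpan F (ha.trans h1) (h2.trans hb)

theorem powSpan_eq_bot {a b : ℤ} (hab : b < a) : powSpan F c a b = ⊥ :=
  le_bot_iff.1 (powSpan_le F fun _ h1 h2 => absurd (h1.trans h2) (not_le.2 hab))

theorem twist_powSpan (i a b : ℤ) :
    twist F i (powSpan F c a b) = powSpan F c (a + i) (b + i) := by
  rw [powSpan, twist_span, ← Set.image_comp, powSpan]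
  congr 1
  ext v
  constructor
  · rintro ⟨t, ht, rfl⟩
    exact ⟨t + i, ⟨by linarith [ht.1], by linarith [ht.2]⟩,
      by simp only [Function.comp, frobVec_frobVec, add_comm]⟩
  · rintro ⟨t, ht, rfl⟩
    exact ⟨t - i, ⟨by linarith [ht.1], by linarith [ht.2]⟩,
      by simp [frobVec_frobVec]⟩

theorem finrank_powSpan_le (a b : ℤ) :
    Module.finrank K (powSpan F c a b) ≤ (b + 1 - a).toNat := by
  classical
  rw [powSpan, ← Finset.coe_Icc, ← Finset.coe_image]
  refine (finrank_span_finset_le_card _).trans (Finset.card_image_le.trans ?_)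
  rw [Int.card_Icc]

theorem finrank_powSpan_le_width (a b : ℤ) :
    Module.finrank K (powSpan F c a b) ≤ s + 1 := by
  simpa using Submodule.finrank_le (powSpan F c a b)

variable {F}

theorem powSpan_eq_top (htop : powSpan F c 0 s = ⊤) {a b : ℤ} (hab : a + s ≤ b) :
    powSpan F c a b = ⊤ := by
  rw [eq_top_iff, ← twist_top F a, ← htop, twist_powSpan]
  exact powSpan_mono F (by omega) (by omega)

/-- Complete the interval to `s + 1` consecutive powers, which span everything; subadditivity of
dimension then leaves no room for a dependence. -/
theorem finrank_powSpan (htop : powSpan F c 0 s = ⊤) {a b : ℤ} (hab : b ≤ a + s) :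
    Module.finrank K (powSpan F c a b) = (b + 1 - a).toNat := by
  rcases lt_or_ge b a with h | h
  · rw [powSpan_eq_bot F h, finrank_bot]
    omega
  refine le_antisymm (finrank_powSpan_le F a b) ?_
  have h1 : powSpan F c a b ⊔ powSpan F c (b + 1) (a + s) = ⊤ := by
    rw [eq_top_iff, ← powSpan_eq_top htop (le_refl (a + s))]
    refine powSpan_le F fun t h1 h2 => ?_
    rcases le_or_gt t b with h3 | h3
    · exact Submodule.mem_sup_left (frobVec_mem_powSpan F h1 h3)
    · exact Submodule.mem_sup_right (frobVec_mem_powSpan F h3 h2)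
  have h2 := Submodule.finrank_add_le_finrank_add_finrank (powSpan F c a b)
    (powSpan F c (b + 1) (a + s))
  have h3 := finrank_powSpan_le F (c := c) (b + 1) (a + s)
  rw [h1, finrank_top, Module.finrank_fin_fun] at h2
  omega

end PowSpan

/-! ### The code on the grid, and the consequences of assumption (2) -/

section Code

variable (F : Type*) {K : Type*} [Field F] [Fintype F] [Field K] [Finite K] [Algebra F K]
variable {n s : ℕ}

/-- The columns of the twist by `t` of the code generated by `y^{[0,0]}, …, y^{[0,r-1]}`. -/
def codeColumn (c : Fin (s + 1) → K) (r : ℕ) (t j : ℤ) : Submodule K (Fin (s + 1) → K) :=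
  if t ≤ j ∧ j < t + r then Submodule.span K {frobVec F t c} else ⊥

/-- The columns of the sum of the twists by `u, …, u + w` of this code. -/
def sumColumn (c : Fin (s + 1) → K) (r : ℕ) (w u j : ℤ) : Submodule K (Fin (s + 1) → K) :=
  powSpan F c (max u (j - r + 1)) (min (u + w) j)

variable {c : Fin (s + 1) → K} {r : ℕ} {h : Fin (s + 1) → Fin n → K}

theorem twist_codeColumn (i t j : ℤ) :
    twist F i (codeColumn F c r t (j - i)) = codeColumn F c r (t + i) j := by
  have hiff : (t ≤ j - i ∧ j - i < t + r) ↔ (t + i ≤ j ∧ j < t + i + r) := by omega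
  unfold codeColumn
  simp only [hiff]
  split_ifs
  · rw [twist_span, Set.image_singleton, frobVec_frobVec, add_comm i t]
  · exact twist_bot F i

theorem twist_sumColumn (w i u j : ℤ) :
    twist F i (sumColumn F c r w u (j - i)) = sumColumn F c r w (u + i) j := by
  unfold sumColumn
  rw [twist_powSpan]
  congr 1 <;> omega

theorem codeColumn_le_sumColumn {w u t : ℤ} (h1 : u ≤ t) (h2 : t ≤ u + w) (j : ℤ) :
    codeColumn F c r t j ≤ sumColumn F c r w u j := by
  unfold codeColumn
  split_ifs with hj
  · rw [Submodule.span_singleton_le_iff_mem]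
    exact frobVec_mem_powSpan F (by omega) (by omega)
  · exact bot_le

theorem iSup_codeColumn (w : ℕ) (j : ℤ) :
    ⨆ i ∈ Finset.range (w + 1), codeColumn F c r (i : ℤ) j = sumColumn F c r w 0 j := by
  apply le_antisymm
  · refine iSup₂_le fun i hi => codeColumn_le_sumColumn F (by omega) ?_ j
    have := Finset.mem_range.1 hi
    omega
  · refine powSpan_le F fun t h1 h2 => ?_
    refine Submodule.mem_iSup_of_mem t.toNat (Submodule.mem_iSup_of_mem ?_ ?_)
    · rw [Finset.mem_range]
      omega
    · rw [codeColumn, Int.toNat_of_nonneg (by omega), if_pos (by omega)]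
      exact Submodule.mem_span_singleton_self _

theorem ofColumns_codeColumn_zero (β : Fin s → K) :
    Submodule.span K {v | ∃ i : ℕ, i < r ∧ v = yVec F h β 0 i} =
      ofColumns F h (codeColumn F (withOne β) r 0) := by
  apply le_antisymm
  · rw [Submodule.span_le]
    rintro _ ⟨i, hi, rfl⟩
    rw [yVec_eq_colMap]
    refine colMap_mem_ofColumns F h ?_
    rw [codeColumn, if_pos (by omega)]
    exact Submodule.mem_span_singleton_self _
  · refine ofColumns_le F h fun j v hv => ?_
    unfold codeColumn at hv
    split_ifs at hv with hj
    · obtain ⟨a, rfl⟩ := Submodule.mem_span_singleton.1 hv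
      rw [map_smul, ← yVec_eq_colMap]
      refine Submodule.smul_mem _ _ (Submodule.subset_span ⟨j.toNat, by omega, ?_⟩)
      rw [Int.toNat_of_nonneg hj.1]
    · rw [(Submodule.mem_bot K).1 hv, map_zero]
      exact zero_mem _

variable (h c r) in
/-- The code `D` is generated by `∑_b c_b h_b^[i]`, `i = 0, …, r - 1`, and the sum of its first
twists is as large as it can be. -/
structure Generic (D : Submodule K (Fin n → K)) : Prop where
  eq_ofColumns : D = ofColumns F h (codeColumn F c r 0)
  powSpan_top : powSpan F c 0 s = ⊤
  indep_zero : ColumnsIndep F h (sumColumn F c r (s + 1) 0)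

variable {F} {D : Submodule K (Fin n → K)}

theorem Generic.twist_eq (H : Generic F c r h D) (t : ℤ) :
    twist F t D = ofColumns F h (codeColumn F c r t) := by
  rw [H.eq_ofColumns, twist_ofColumns]
  simp_rw [twist_codeColumn, zero_add]

theorem Generic.indep (H : Generic F c r h D) (u : ℤ) :
    ColumnsIndep F h (sumColumn F c r (s + 1) u) := by
  have := H.indep_zero.twist u
  simp_rw [twist_sumColumn, zero_add] at this
  exact this

theorem finrank_sumColumn_le (j : ℕ) :
    Module.finrank K (sumColumn F c r (s + 1) 0 j) ≤
      min (s + 1) (min (s + 1) j + 1 - (j + 1 - r)) := by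
  refine le_min (finrank_powSpan_le_width F _ _) ((finrank_powSpan_le F _ _).trans ?_)
  omega

/-- The dimension equals the sum of the column bounds, so every inequality on the way is an
equality: columns are independent, and each attains its bound. Only the code enters the hypothesis
on dimension, so this applies to every solution. -/
theorem generic_of_finrank {β : Fin s → K} (hr : s + 1 ≤ r)
    (hD : D = Submodule.span K {v | ∃ i : ℕ, i < r ∧ v = yVec F h β 0 i})
    (h2 : Module.finrank K
        (⨆ i ∈ Finset.range (s + 2), twist F (i : ℤ) D : Submodule K (Fin n → K)) =
      (s + 1) * r + (s + 1)) : Generic F (withOne β) r h D := by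
  have h1 : D = ofColumns F h (codeColumn F (withOne β) r 0) := by
    rw [hD, ofColumns_codeColumn_zero]
  have htw : ∀ t, twist F t D = ofColumns F h (codeColumn F (withOne β) r t) := fun t => by
    rw [h1, twist_ofColumns]
    simp_rw [twist_codeColumn, zero_add]
  have hsum : (⨆ i ∈ Finset.range (s + 2), twist F (i : ℤ) D) =
      ofColumns F h (sumColumn F (withOne β) r (s + 1) 0) := by
    have : sumColumn F (withOne β) r (s + 1) 0 = fun j =>
        ⨆ i ∈ Finset.range (s + 2), codeColumn F (withOne β) r (i : ℤ) j := by
      funext j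
      rw [iSup_codeColumn]
      push_cast
      rfl
    rw [this]
    simp_rw [ofColumns_iSup, htw]
  set S : Finset ℤ := (Finset.range (r + s + 1)).map Nat.castEmbedding with hS
  have hoff : ∀ j ∉ S, sumColumn F (withOne β) r (s + 1) 0 j = ⊥ := by
    intro j hj
    refine powSpan_eq_bot F ?_
    by_contra hlt
    refine hj (Finset.mem_map.2 ⟨j.toNat, Finset.mem_range.2 (by omega), ?_⟩)
    simp only [Nat.castEmbedding_apply]
    omega
  have hle : ∀ j ∈ Finset.range (r + s + 1),
      Module.finrank K (sumColumn F (withOne β) r (s + 1) 0 j) ≤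
        min (s + 1) (min (s + 1) j + 1 - (j + 1 - r)) := fun j _ => finrank_sumColumn_le j
  have hSsum : ∑ j ∈ S, Module.finrank K (sumColumn F (withOne β) r (s + 1) 0 j) ≤
      (s + 1) * r + (s + 1) := by
    rw [hS, Finset.sum_map, ← sum_min_eq s r hr]
    exact Finset.sum_le_sum hle
  rw [hsum] at h2
  have hind := columnsIndep_of_sum_le hoff (hSsum.trans h2.ge)
  refine ⟨h1, ?_, hind⟩
  rw [finrank_ofColumns hind (fun _ => le_rfl) hoff, hS, Finset.sum_map, ← sum_min_eq s r hr] at h2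
  -- Column `s` has rows exactly `0..s` and bound `s + 1`, so these powers span.
  have h3 := (Finset.sum_eq_sum_iff_of_le hle).1 h2 s (Finset.mem_range.2 (by omega))
  apply Submodule.eq_top_of_finrank_eq
  rw [Module.finrank_fin_fun]
  refine le_antisymm (finrank_powSpan_le_width F _ _) ?_
  have h4 : sumColumn F (withOne β) r (s + 1) 0 (s : ℤ) ≤ powSpan F (withOne β) 0 s :=
    powSpan_mono F (by omega) (by omega)
  have h5 := Submodule.finrank_mono h4
  omega

end Code

/-! ### The space `A` -/

section AlgorithmA

variable {F : Type*} {K : Type*} [Field F] [Fintype F] [Field K] [Finite K] [Algebra F K]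
variable {n s : ℕ} {c : Fin (s + 1) → K} {r : ℕ} {h : Fin (s + 1) → Fin n → K}
variable {D : Submodule K (Fin n → K)}

theorem powSpan_le_powSpan (htop : powSpan F c 0 s = ⊤) {a b a' b' : ℤ}
    (hab : a' ≤ a ∧ b ≤ b' ∨ a' + s ≤ b' ∨ b < a) : powSpan F c a b ≤ powSpan F c a' b' := by
  rcases hab with ⟨h1, h2⟩ | h1 | h1
  · exact powSpan_mono F h1 h2
  · rw [powSpan_eq_top htop h1]
    exact le_top
  · rw [powSpan_eq_bot F h1]
    exact bot_le

theorem Generic.colMap_mem_twist (H : Generic F c r h D) {t j : ℤ} (h1 : t ≤ j)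
    (h2 : j < t + r) : colMap F h j (frobVec F t c) ∈ twist F t D := by
  rw [H.twist_eq]
  refine colMap_mem_ofColumns F h ?_
  rw [codeColumn, if_pos ⟨h1, h2⟩]
  exact Submodule.mem_span_singleton_self _

/-- Row `t` has at most a line in each column, so a column that avoids `c^[t]` contributes nothing.
The parameter `u` selects an independent family containing both spaces. -/
theorem Generic.inf_twist_le (H : Generic F c r h D) {X : ℤ → Submodule K (Fin (s + 1) → K)}
    {u t j₀ : ℤ} (h1 : u ≤ t) (h2 : t ≤ u + (s + 1))
    (hX : ∀ j, X j ≤ sumColumn F c r (s + 1) u j)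
    (hnot : ∀ j, t ≤ j → j < t + r → j ≠ j₀ → frobVec F t c ∉ X j) :
    ofColumns F h X ⊓ twist F t D ≤ Submodule.span K {colMap F h j₀ (frobVec F t c)} := by
  rw [H.twist_eq, ofColumns_inf (H.indep u) hX (codeColumn_le_sumColumn F h1 h2)]
  refine ofColumns_le F h fun j v hv => ?_
  obtain ⟨hvX, hv⟩ := hv
  unfold codeColumn at hv
  split_ifs at hv with hj
  · obtain ⟨a, rfl⟩ := Submodule.mem_span_singleton.1 hv
    by_cases hjj : j = j₀
    · subst hjj
      rw [map_smul]
      exact Submodule.smul_mem _ _ (Submodule.mem_span_singleton_self _)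
    · by_cases ha : a = 0
      · rw [ha, zero_smul, map_zero]
        exact zero_mem _
      · exact absurd ((Submodule.smul_mem_iff _ ha).1 hvX) (hnot j hj.1 hj.2 hjj)
  · rw [(Submodule.mem_bot K).1 hv, map_zero]
    exact zero_mem _

variable (F c r) in
/-- The columns of the intersection of the twists by `0, -1, …, -m` of `algS`. -/
def interColumn (m j : ℤ) : Submodule K (Fin (s + 1) → K) :=
  if j + m + 1 ≤ r then powSpan F c 0 (min j s) else powSpan F c (j - r + 1) (s - m)

theorem Generic.algS_eq (H : Generic F c r h D) :
    algS F (s + 1) D = ofColumns F h (sumColumn F c r s 0) := by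
  have : sumColumn F c r s 0 = fun j =>
      ⨆ i ∈ Finset.range (s + 1), codeColumn F c r (i : ℤ) j := by
    funext j
    rw [iSup_codeColumn]
  rw [this]
  simp_rw [ofColumns_iSup, ← H.twist_eq]
  rfl

theorem twist_interColumn (m j : ℤ) : twist F (-1) (interColumn F c r m (j - (-1))) =
    if j + m + 2 ≤ r then powSpan F c (-1) (min (j + 1) s - 1)
      else powSpan F c (j - r + 1) (s - m - 1) := by
  unfold interColumn
  split_ifs with h1 h2 h2
  · rw [twist_powSpan]
    congr 1
  · omega
  · omega
  · rw [twist_powSpan]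
    congr 1
    omega

/-- In each column one of the two spaces contains the other, because an interval of at least `s + 1`
exponents already gives the full column. -/
theorem Generic.sumColumn_inf (H : Generic F c r h D) (hr : s + 1 ≤ r) {m : ℤ} (hm0 : 0 ≤ m)
    (hm : m + s + 1 ≤ r) (j : ℤ) :
    sumColumn F c r s 0 j ⊓ twist F (-1) (interColumn F c r m (j - (-1))) =
      interColumn F c r (m + 1) j := by
  rw [twist_interColumn, interColumn, sumColumn]
  have htop := H.powSpan_top
  split_ifs with h1 h2 h2
  · apply le_antisymm
    · exact inf_le_left.trans (powSpan_le_powSpan htop (by omega))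
    · exact le_inf (powSpan_le_powSpan htop (by omega)) (powSpan_le_powSpan htop (by omega))
  · omega
  · omega
  · apply le_antisymm
    · exact inf_le_right.trans (powSpan_le_powSpan htop (by omega))
    · exact le_inf (powSpan_le_powSpan htop (by omega)) (powSpan_le_powSpan htop (by omega))

theorem Generic.iInf_algS (H : Generic F c r h D) (hr : s + 1 ≤ r) (m : ℕ) (hm : m + s ≤ r) :
    ⨅ i ∈ Finset.range (m + 1), twist F (i : ℤ) (algS F (s + 1) D) =
      twist F m (ofColumns F h (interColumn F c r m)) := by
  have htop := H.powSpan_top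
  induction m with
  | zero =>
    simp only [zero_add, Finset.range_one, Finset.mem_singleton, iInf_iInf_eq_left, Nat.cast_zero,
      twist_zero, H.algS_eq]
    congr 1
    funext j
    unfold interColumn sumColumn
    split_ifs with h1
    · apply le_antisymm <;> exact powSpan_le_powSpan htop (by omega)
    · apply le_antisymm <;> exact powSpan_le_powSpan htop (by omega)
  | succ m ih =>
    -- Normalised by the twist `-m`, the intersections satisfy `I_{m+1} = S_0 ∩ I_m^[-1]`; rows
    -- `-1..s` contain both terms.
    have h1 : ofColumns F h (interColumn F c r (m + 1 : ℕ)) = algS F (s + 1) D ⊓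
        twist F (-1) (ofColumns F h (interColumn F c r m)) := by
      rw [H.algS_eq, twist_ofColumns, ofColumns_inf (H.indep (-1))]
      · congr 1
        funext j
        rw [H.sumColumn_inf hr (by omega) (by omega)]
        push_cast
        rfl
      · exact fun j => powSpan_le_powSpan htop (by omega)
      · intro j
        rw [twist_interColumn]
        unfold sumColumn
        split_ifs <;> exact powSpan_le_powSpan htop (by omega)
    rw [Finset.range_add_one, Finset.iInf_insert, ih (by omega), h1, twist_inf, twist_twist]
    congr 2
    push_cast
    ring

variable (F c r) in
/-- The columns of `algA`. -/
def algAColumn (j : ℤ) : Submodule K (Fin (s + 1) → K) :=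
  if j < s then powSpan F c 0 j else powSpan F c (j - r + 1) (2 * s - r)

theorem Generic.algA_eq {k : ℕ} (H : Generic F c (n - k) h D) (hr : s + 1 ≤ n - k) :
    algA F k (s + 1) D = ofColumns F h (algAColumn F c (n - k)) := by
  unfold algA
  have hd : algd n k (s + 1) = n - k - s := by
    unfold algd
    omega
  rw [hd, H.iInf_algS hr _ (by omega), twist_twist, neg_add_cancel, twist_zero]
  congr 1
  funext j
  unfold interColumn algAColumn
  split_ifs
  · congr 1
    omega
  · omega
  · omega
  · congr 1
    omega

end AlgorithmA

/-! ### Powers with non-consecutive exponents -/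

section Moore

theorem span_singleton_eq_of_mem {K V : Type*} [Field K] [AddCommGroup V] [Module K V] {x y : V}
    (hx : x ∈ Submodule.span K {y}) (hx0 : x ≠ 0) :
    Submodule.span K {y} = Submodule.span K {x} := by
  obtain ⟨a, rfl⟩ := Submodule.mem_span_singleton.1 hx
  have ha : a ≠ 0 := fun ha => hx0 (by rw [ha, zero_smul])
  exact (Submodule.span_singleton_smul_eq (IsUnit.mk0 a ha) y).symm
variable (F : Type*) {K : Type*} [Field F] [Fintype F] [Field K] [Finite K] [Algebra F K]
variable {s : ℕ}

/-- Any `s + 1` distinct powers of `c`, with exponents in a window of length `r`, span. -/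
def PowersSpan (r : ℕ) (c : Fin (s + 1) → K) : Prop :=
  ∀ (T : Finset ℤ) (w : ℤ), T.card = s + 1 → (∀ t ∈ T, w ≤ t ∧ t < w + r) →
    Submodule.span K ((fun t : ℤ => frobVec F t c) '' T) = ⊤

variable {F}

theorem MooreNondegenerate.powersSpan {r : ℕ} {β : Fin s → K} (hβ : MooreNondegenerate F r β) :
    PowersSpan F r (withOne β) := by
  intro T w hT hw
  let e := T.equivFinOfCardEq hT
  let i : Fin (s + 1) → ℕ := fun a => ((e.symm a : ℤ) - w).toNat
  have hi : ∀ a, (i a : ℤ) = (e.symm a : ℤ) - w := fun a =>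
    Int.toNat_of_nonneg (by linarith [(hw _ (e.symm a).2).1])
  have hdet := hβ i
    (fun a b hab => by
      have h1 := hi a
      rw [hab, hi b] at h1
      exact e.symm.injective (Subtype.ext (by omega)))
    (fun a => by
      have h1 := (hw _ (e.symm a).2).2
      have h2 := hi a
      omega)
  have hli : LinearIndependent K (mooreMatrix F β i).row :=
    Matrix.linearIndependent_rows_of_det_ne_zero hdet
  have htop := hli.span_eq_top_of_card_eq_finrank' (by simp)
  rw [eq_top_iff, ← twist_top F w, ← htop, twist_span, Submodule.span_le]
  rintro _ ⟨_, ⟨a, rfl⟩, rfl⟩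
  refine Submodule.subset_span ⟨e.symm a, (e.symm a).2, ?_⟩
  have h1 : (mooreMatrix F β i).row a = frobVec F (i a) (withOne β) := rfl
  rw [h1, frobVec_frobVec, hi]
  simp

/-- The at most `s` exponents of the interval, together with `t`, extend to `s + 1` exponents in one
window of length `r`. If `c^[t]` were redundant, the other `s` powers would span `K^{s+1}`. -/
theorem PowersSpan.notMem_powSpan {r : ℕ} {c : Fin (s + 1) → K} (hc : PowersSpan F r c)
    (hr : s + 1 ≤ r) {a b t : ℤ} (hab : b < a + s)
    (ht : t < a ∧ b < t + r ∧ 0 < r ∨ b < t ∧ t < a + r) : frobVec F t c ∉ powSpan F c a b := by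
  classical
  intro hmem
  obtain ⟨w, hw⟩ : ∃ w : ℤ, w ≤ t ∧ t < w + r ∧ ∀ x, a ≤ x → x ≤ b → w ≤ x ∧ x < w + r := by
    rcases ht with ht | ht
    · exact ⟨t, by omega, by omega, fun x _ _ => by omega⟩
    · rcases le_total a t with hat | hat
      · exact ⟨a, by omega, by omega, fun x _ _ => by omega⟩
      · exact ⟨t, by omega, by omega, fun x _ _ => by omega⟩
  have htn : t ∉ Finset.Icc a b := by
    rw [Finset.mem_Icc]
    omega
  obtain ⟨T, h1, h2, h3⟩ := Finset.exists_subsuperset_card_eq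
    (s := insert t (Finset.Icc a b)) (t := Finset.Ico w (w + r)) (n := s + 1)
    (by
      intro x hx
      rw [Finset.mem_Ico]
      rcases Finset.mem_insert.1 hx with rfl | hx
      · exact ⟨hw.1, hw.2.1⟩
      · exact hw.2.2 x (Finset.mem_Icc.1 hx).1 (Finset.mem_Icc.1 hx).2)
    (by
      rw [Finset.card_insert_of_notMem htn, Int.card_Icc]
      omega)
    (by
      rw [Int.card_Ico]
      omega)
  have htT : t ∈ T := h1 (Finset.mem_insert_self _ _)
  have htop := hc T w h3 fun x hx => Finset.mem_Ico.1 (h2 hx)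
  have hle : (⊤ : Submodule K (Fin (s + 1) → K)) ≤
      Submodule.span K ((T.erase t).image fun t : ℤ => frobVec F t c : Finset (Fin (s + 1) → K)) := by
    rw [← htop, Submodule.span_le]
    rintro _ ⟨x, hx, rfl⟩
    by_cases hxt : x = t
    · subst hxt
      refine powSpan_le F (fun y hy1 hy2 => Submodule.subset_span ?_) hmem
      refine Finset.mem_coe.2 (Finset.mem_image_of_mem _ (Finset.mem_erase.2 ⟨?_, ?_⟩))
      · rintro rfl
        exact htn (Finset.mem_Icc.2 ⟨hy1, hy2⟩)
      · exact h1 (Finset.mem_insert_of_mem (Finset.mem_Icc.2 ⟨hy1, hy2⟩))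
    · exact Submodule.subset_span
        (Finset.mem_coe.2 (Finset.mem_image_of_mem _ (Finset.mem_erase.2 ⟨hxt, hx⟩)))
  have h4 := (Submodule.finrank_mono hle).trans
    ((finrank_span_finset_le_card _).trans Finset.card_image_le)
  rw [finrank_top, Module.finrank_fin_fun, Finset.card_erase_of_mem htT] at h4
  omega

end Moore

/-! ### The spaces `D_{λ-1}`, `B_l` and `D_l` -/

section Steps

variable {F : Type*} {K : Type*} [Field F] [Fintype F] [Field K] [Finite K] [Algebra F K]
variable {n k s : ℕ} {c : Fin (s + 1) → K} {h : Fin (s + 1) → Fin n → K}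
variable {D : Submodule K (Fin n → K)}

theorem Generic.colMap_injective {r : ℕ} (H : Generic F c r h D) (hr : s + 1 ≤ r) (j : ℤ) :
    Function.Injective (colMap F h j) := by
  rw [injective_iff_map_eq_zero]
  intro v hv
  have htop : sumColumn F c r (s + 1) (j - s) j = ⊤ :=
    powSpan_eq_top H.powSpan_top (by omega)
  have := H.indep (j - s) {j} (fun i => if i = j then v else 0)
    (fun i => by
      split_ifs with hi
      · rw [hi, htop]
        exact Submodule.mem_top
      · exact zero_mem _)
    (by simpa using hv) j (Finset.mem_singleton_self j)
  simpa using this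

theorem Generic.colMap_ne_zero {r : ℕ} {β : Fin s → K} (H : Generic F (withOne β) r h D)
    (hr : s + 1 ≤ r) (t j : ℤ) : colMap F h j (frobVec F t (withOne β)) ≠ 0 := by
  intro h0
  have h1 := H.colMap_injective hr j (h0.trans (map_zero _).symm)
  have h2 := congrFun h1 0
  simp [frobVec, withOne, frob] at h2

theorem twist_span_colMap (i t j : ℤ) :
    twist F i (Submodule.span K {colMap F h j (frobVec F t c)}) =
      Submodule.span K {colMap F h (j + i) (frobVec F (i + t) c)} := by
  rw [twist_span, Set.image_singleton, frobVec_colMap, frobVec_frobVec]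

theorem algDLast_eq_inf (hr : s + 1 ≤ n - k) : algDLast F k (s + 1) D =
    twist F (s - 1) (algA F k (s + 1) D) ⊓ twist F (2 * s - (n - k : ℕ)) D := by
  unfold algDLast algd
  congr 2 <;> omega

theorem Generic.twist_algA_eq (H : Generic F c (n - k) h D) (hr : s + 1 ≤ n - k) :
    twist F (s - 1) (algA F k (s + 1) D) = ofColumns F h fun j : ℤ =>
      if j < 2 * s - 1 then powSpan F c (s - 1) j
        else powSpan F c (j - (n - k : ℕ) + 1) (3 * s - 1 - (n - k : ℕ)) := by
  rw [H.algA_eq hr, twist_ofColumns]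
  congr 1
  funext j
  unfold algAColumn
  split_ifs
  · rw [twist_powSpan]
    congr 1 <;> omega
  · omega
  · omega
  · rw [twist_powSpan]
    congr 1 <;> omega

theorem Generic.mem_algDLast (H : Generic F c (n - k) h D) (hs : 1 ≤ s)
    (hr : 2 * (s + 1) ≤ n - k) :
    colMap F h (2 * s - 1) (frobVec F (2 * s - (n - k : ℕ)) c) ∈ algDLast F k (s + 1) D := by
  rw [algDLast_eq_inf (by omega), H.twist_algA_eq (by omega)]
  refine ⟨colMap_mem_ofColumns F h ?_, H.colMap_mem_twist (by omega) (by omega)⟩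
  rw [if_neg (by omega)]
  exact frobVec_mem_powSpan F (by omega) (by omega)

/-- Row `2s - r` ends at column `2s - 1`, which is also the one column where the interval of
`A^[s-1]` contains the exponent `2s - r`; elsewhere condition (1) excludes `c^[2s-r]`. -/
theorem Generic.algDLast_le (H : Generic F c (n - k) h D) (hc : PowersSpan F (n - k) c)
    (hs : 1 ≤ s) (hr : 2 * (s + 1) ≤ n - k) : algDLast F k (s + 1) D ≤
      Submodule.span K {colMap F h (2 * s - 1) (frobVec F (2 * s - (n - k : ℕ)) c)} := by
  rw [algDLast_eq_inf (by omega), H.twist_algA_eq (by omega)]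
  refine H.inf_twist_le (u := 2 * s - 1 - (n - k : ℕ)) (by omega) (by omega) (fun j => ?_)
    fun j h1 h2 h3 => ?_
  · unfold sumColumn
    split_ifs <;> exact powSpan_le_powSpan H.powSpan_top (by omega)
  · split_ifs <;> exact hc.notMem_powSpan (by omega) (by omega) (by omega)

variable (F k D s) in
/-- The spaces `B_l` of the algorithm. -/
def algB (l : ℕ) : Submodule K (Fin n → K) :=
  if l = 0 then algBZero F k (s + 1) D
    else algA F k (s + 1) D ⊔ ⨆ j : Fin l, twist F ((l : ℤ) - (j : ℕ)) (algD F k (s + 1) D j)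

theorem algD_eq_inf (l : ℕ) : algD F k (s + 1) D l = algB F k s D l ⊓ twist F (-1) D := by
  rw [algD, algB]

theorem algA_le_algB (l : ℕ) : algA F k (s + 1) D ≤ algB F k s D l := by
  unfold algB
  split_ifs
  exacts [le_sup_left, le_sup_left]

variable (F c) in
/-- The columns of `B_l`. -/
def algBColumn (r l : ℕ) (j : ℤ) : Submodule K (Fin (s + 1) → K) :=
  if j = s - 1 + l then ⊤ else algAColumn F c r j

variable (F k c h D) in
/-- The spaces `D_{λ-1}` and `D_j`, for `j < l`, are the lines expected from the solution. -/
structure LinesBelow (l : ℕ) : Prop where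
  last : algDLast F k (s + 1) D =
    Submodule.span K {colMap F h (2 * s - 1) (frobVec F (2 * s - (n - k : ℕ)) c)}
  line : ∀ j < l, algD F k (s + 1) D j =
    Submodule.span K {colMap F h (s - 1 + j) (frobVec F (-1) c)}

theorem LinesBelow.twist_last {l : ℕ} (L : LinesBelow F k c h D l) :
    twist F (1 - ((s + 1 : ℕ) : ℤ)) (algDLast F k (s + 1) D) =
      Submodule.span K {colMap F h (s - 1) (frobVec F (s - (n - k : ℕ)) c)} := by
  rw [L.last, twist_span_colMap]
  have h1 : 2 * (s : ℤ) - 1 + (1 - ((s + 1 : ℕ) : ℤ)) = s - 1 := by omega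
  have h2 : 1 - ((s + 1 : ℕ) : ℤ) + (2 * s - (n - k : ℕ)) = s - (n - k : ℕ) := by omega
  rw [h1, h2]

theorem LinesBelow.twist_line {l : ℕ} (L : LinesBelow F k c h D l) (j : Fin l) :
    twist F ((l : ℤ) - (j : ℕ)) (algD F k (s + 1) D j) =
      Submodule.span K {colMap F h (s - 1 + l) (frobVec F (l - 1 - (j : ℕ)) c)} := by
  rw [L.line j j.2, twist_span_colMap]
  have h1 : (s : ℤ) - 1 + (j : ℕ) + (l - (j : ℕ)) = s - 1 + l := by omega
  have h2 : (l : ℤ) - (j : ℕ) + -1 = l - 1 - (j : ℕ) := by omega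
  rw [h1, h2]

/-- All cells added to `A` land in column `s - 1 + l`. Condition (1) plays no role, so the bound is
available for every solution. -/
theorem Generic.algB_le (H : Generic F c (n - k) h D) (hr : s + 1 ≤ n - k) {l : ℕ}
    (L : LinesBelow F k c h D l) :
    algB F k s D l ≤ ofColumns F h (algBColumn F c (n - k) l) := by
  have hA : algA F k (s + 1) D ≤ ofColumns F h (algBColumn F c (n - k) l) := by
    rw [H.algA_eq hr]
    refine ofColumns_mono F h fun j => ?_
    unfold algBColumn
    split_ifs
    exacts [le_top, le_rfl]
  have hmem : ∀ v, colMap F h (s - 1 + l) v ∈ ofColumns F h (algBColumn F c (n - k) l) :=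
    fun v => colMap_mem_ofColumns F h (by rw [algBColumn, if_pos rfl]; exact Submodule.mem_top)
  unfold algB
  split_ifs with hl
  · subst hl
    rw [algBZero, L.twist_last]
    refine sup_le hA ((Submodule.span_singleton_le_iff_mem _ _).2 ?_)
    simpa using hmem (frobVec F (s - (n - k : ℕ)) c)
  · refine sup_le hA (iSup_le fun j => ?_)
    rw [L.twist_line, Submodule.span_singleton_le_iff_mem]
    exact hmem _

theorem Generic.le_algB (H : Generic F c (n - k) h D) (hc : PowersSpan F (n - k) c)
    (hr : 2 * (s + 1) ≤ n - k) {l : ℕ} (hl : l < s)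
    (L : LinesBelow F k c h D l) :
    ofColumns F h (algBColumn F c (n - k) l) ≤ algB F k s D l := by
  classical
  have hA := algA_le_algB (F := F) (k := k) (s := s) (D := D) l
  rw [H.algA_eq (by omega)] at hA
  have key : ∃ (T : Finset ℤ) (w : ℤ), T.card = s + 1 ∧ (∀ t ∈ T, w ≤ t ∧ t < w + (n - k : ℕ)) ∧
      ∀ t ∈ T, colMap F h (s - 1 + l) (frobVec F t c) ∈ algB F k s D l := by
    rcases Nat.eq_zero_or_pos l with rfl | hl0
    -- In column `s - 1`, `A` supplies rows `0..s-1` and the twisted `D_{λ-1}` supplies row `s - r`.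
    · refine ⟨insert ((s : ℤ) - (n - k : ℕ)) (Finset.Icc 0 (s - 1)), s - (n - k : ℕ), ?_, ?_, ?_⟩
      · rw [Finset.card_insert_of_notMem (by rw [Finset.mem_Icc]; omega), Int.card_Icc]
        omega
      · intro t ht
        rw [Finset.mem_insert, Finset.mem_Icc] at ht
        omega
      · intro t ht
        rw [Finset.mem_insert, Finset.mem_Icc] at ht
        rcases ht with rfl | ht
        · rw [algB, if_pos rfl, algBZero, L.twist_last]
          refine Submodule.mem_sup_right ?_
          simp
        · refine hA (colMap_mem_ofColumns F h ?_)
          rw [algAColumn, if_pos (by omega)]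
          exact frobVec_mem_powSpan F (by omega) (by omega)
    -- In column `s - 1 + l`, `A` supplies `s + 1 - l` rows and the twisted `D_j`, `j < l`, supply
    -- the rows `l - 1 - j`, that is `0..l-1`.
    · refine ⟨Finset.Icc (s + l - (n - k : ℕ)) (2 * s - (n - k : ℕ)) ∪ Finset.Icc 0 ((l : ℤ) - 1),
        s + l - (n - k : ℕ), ?_, ?_, ?_⟩
      · rw [Finset.card_union_of_disjoint, Int.card_Icc, Int.card_Icc]
        · omega
        · rw [Finset.disjoint_left]
          intro t h1 h2
          rw [Finset.mem_Icc] at h1 h2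
          omega
      · intro t ht
        rw [Finset.mem_union, Finset.mem_Icc, Finset.mem_Icc] at ht
        omega
      · intro t ht
        rw [Finset.mem_union, Finset.mem_Icc, Finset.mem_Icc] at ht
        rcases ht with ht | ht
        · refine hA (colMap_mem_ofColumns F h ?_)
          rw [algAColumn, if_neg (by omega)]
          exact frobVec_mem_powSpan F (by omega) (by omega)
        · rw [algB, if_neg (by omega)]
          refine Submodule.mem_sup_right
            (Submodule.mem_iSup_of_mem ⟨(l - 1 - t).toNat, by omega⟩ ?_)
          rw [L.twist_line]
          have h1 : (l : ℤ) - 1 - ((l - 1 - t).toNat : ℕ) = t := by omega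
          simp only [h1]
          exact Submodule.mem_span_singleton_self _
  obtain ⟨T, w, hT, hw, hmem⟩ := key
  have htop : ⊤ ≤ (algB F k s D l).comap (colMap F h (s - 1 + l)) := by
    rw [← hc T w hT hw, Submodule.span_le]
    rintro _ ⟨t, ht, rfl⟩
    exact hmem t ht
  refine ofColumns_le F h fun j v hv => ?_
  unfold algBColumn at hv
  split_ifs at hv with hj
  · rw [hj]
    exact htop hv
  · exact hA (colMap_mem_ofColumns F h hv)

theorem Generic.algBColumn_le (H : Generic F c (n - k) h D) (hr : 2 * (s + 1) ≤ n - k) {l : ℕ}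
    (hl : l < s) (j : ℤ) :
    algBColumn F c (n - k) l j ≤ sumColumn F c (n - k) (s + 1) (-1) j := by
  unfold algBColumn algAColumn sumColumn
  split_ifs with h1
  -- Starting at row `-1` matters: for `l = 0` the rows `-1..s-1` are just enough to fill the
  -- column.
  · rw [powSpan_eq_top H.powSpan_top (by omega)]
  all_goals exact powSpan_le_powSpan H.powSpan_top (by omega)

theorem Generic.mem_algD (H : Generic F c (n - k) h D) (hr : 2 * (s + 1) ≤ n - k) {l : ℕ}
    (hl : l < s) (hB : algB F k s D l = ofColumns F h (algBColumn F c (n - k) l)) :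
    colMap F h (s - 1 + l) (frobVec F (-1) c) ∈ algD F k (s + 1) D l := by
  rw [algD_eq_inf, hB]
  refine ⟨colMap_mem_ofColumns F h ?_, H.colMap_mem_twist (by omega) (by omega)⟩
  rw [algBColumn, if_pos rfl]
  exact Submodule.mem_top

/-- Outside the filled column, the exponent `-1` lies just below `0..j` or above `j-r+1..2s-r`, and
these intervals have at most `s` elements. -/
theorem Generic.algD_le (H : Generic F c (n - k) h D) (hc : PowersSpan F (n - k) c)
    (hr : 2 * (s + 1) ≤ n - k) {l : ℕ}
    (hl : l < s) (hB : algB F k s D l = ofColumns F h (algBColumn F c (n - k) l)) :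
    algD F k (s + 1) D l ≤ Submodule.span K {colMap F h (s - 1 + l) (frobVec F (-1) c)} := by
  rw [algD_eq_inf, hB]
  refine H.inf_twist_le (u := -1) le_rfl (by omega) (H.algBColumn_le hr hl) fun j h1 h2 h3 => ?_
  rw [algBColumn, if_neg h3, algAColumn]
  split_ifs <;> exact hc.notMem_powSpan (by omega) (by omega) (by omega)

/-- The dimension of each column is the length of its interval, or `s + 1` in the filled one,
whatever the solution. -/
theorem Generic.finrank_algBColumn_eq {c' : Fin (s + 1) → K} {h' : Fin (s + 1) → Fin n → K}
    (H : Generic F c (n - k) h D) (H' : Generic F c' (n - k) h' D) (hr : 2 * (s + 1) ≤ n - k)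
    {l : ℕ} (hl : l < s) :
    Module.finrank K (ofColumns F h (algBColumn F c (n - k) l)) =
      Module.finrank K (ofColumns F h' (algBColumn F c' (n - k) l)) := by
  have hoff : ∀ c : Fin (s + 1) → K, ∀ j ∉ Finset.Icc (0 : ℤ) (2 * s),
      algBColumn F c (n - k) l j = ⊥ := by
    intro c j hj
    rw [Finset.mem_Icc] at hj
    rw [algBColumn, if_neg (by omega), algAColumn]
    split_ifs <;> exact powSpan_eq_bot F (by omega)
  rw [finrank_ofColumns (H.indep (-1)) (H.algBColumn_le hr hl) (hoff c),
    finrank_ofColumns (H'.indep (-1)) (H'.algBColumn_le hr hl) (hoff c')]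
  refine Finset.sum_congr rfl fun j hj => ?_
  by_cases h1 : j = s - 1 + l
  · rw [algBColumn, algBColumn, if_pos h1, if_pos h1]
  rw [algBColumn, algBColumn, if_neg h1, if_neg h1, algAColumn, algAColumn]
  by_cases h2 : j < s
  · rw [if_pos h2, if_pos h2, finrank_powSpan H.powSpan_top (by omega),
      finrank_powSpan H'.powSpan_top (by omega)]
  · rw [if_neg h2, if_neg h2, finrank_powSpan H.powSpan_top (by omega),
      finrank_powSpan H'.powSpan_top (by omega)]

end Steps

/-! ### Transfer to an arbitrary solution, and the output -/

section Recovery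

variable {F : Type*} {K : Type*} [Field F] [Fintype F] [Field K] [Finite K] [Algebra F K]
variable {n k s : ℕ} {β β' : Fin s → K} {h h' : Fin (s + 1) → Fin n → K}
variable {D : Submodule K (Fin n → K)}

theorem LinesBelow.succ {c : Fin (s + 1) → K} {l : ℕ} (L : LinesBelow F k c h D l)
    (hl : algD F k (s + 1) D l = Submodule.span K {colMap F h (s - 1 + l) (frobVec F (-1) c)}) :
    LinesBelow F k c h D (l + 1) := by
  refine ⟨L.last, fun j hj => ?_⟩
  rcases Nat.lt_succ_iff_lt_or_eq.1 hj with hj | rfl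
  exacts [L.line j hj, hl]

theorem Generic.algB_eq {c : Fin (s + 1) → K} (H : Generic F c (n - k) h D)
    (hc : PowersSpan F (n - k) c) (hr : 2 * (s + 1) ≤ n - k) {l : ℕ} (hl : l < s)
    (L : LinesBelow F k c h D l) :
    algB F k s D l = ofColumns F h (algBColumn F c (n - k) l) :=
  le_antisymm (H.algB_le (by omega) L) (H.le_algB hc hr hl L)

theorem Generic.linesBelow {c : Fin (s + 1) → K} (H : Generic F c (n - k) h D)
    (hc : PowersSpan F (n - k) c) (hs : 1 ≤ s) (hr : 2 * (s + 1) ≤ n - k) (l : ℕ) (hl : l ≤ s) :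
    LinesBelow F k c h D l := by
  induction l with
  | zero =>
    exact ⟨le_antisymm (H.algDLast_le hc hs hr)
      ((Submodule.span_singleton_le_iff_mem _ _).2 (H.mem_algDLast hs hr)),
      fun j hj => absurd hj (Nat.not_lt_zero j)⟩
  | succ l ih =>
    have L := ih (by omega)
    have hB := H.algB_eq hc hr (by omega) L
    exact L.succ (le_antisymm (H.algD_le hc hr (by omega) hB)
      ((Submodule.span_singleton_le_iff_mem _ _).2 (H.mem_algD hr (by omega) hB)))

/-- The spaces `D_l` computed from `D` are the lines of any other solution, too. -/
theorem Generic.linesBelow_of_generic (H : Generic F (withOne β) (n - k) h D)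
    (hβ : PowersSpan F (n - k) (withOne β)) (H' : Generic F (withOne β') (n - k) h' D)
    (hs : 1 ≤ s) (hr : 2 * (s + 1) ≤ n - k) (l : ℕ) (hl : l ≤ s) :
    LinesBelow F k (withOne β') h' D l := by
  have L := H.linesBelow hβ hs hr
  induction l with
  | zero =>
    have h1 := H'.mem_algDLast hs hr
    rw [(L 0 hl).last] at h1
    refine ⟨?_, fun j hj => absurd hj (Nat.not_lt_zero j)⟩
    rw [(L 0 hl).last]
    exact span_singleton_eq_of_mem h1 (H'.colMap_ne_zero (by omega) _ _)
  | succ l ih =>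
    have L' := ih (by omega)
    -- Condition (1) is not known for `β'`, so the reverse inclusion is replaced by a dimension
    -- count through the first solution.
    have hB : algB F k s D l = ofColumns F h' (algBColumn F (withOne β') (n - k) l) := by
      refine Submodule.eq_of_le_of_finrank_eq (H'.algB_le (by omega) L') ?_
      rw [H.algB_eq hβ hr (by omega) (L l (by omega))]
      exact H.finrank_algBColumn_eq H' hr (by omega)
    have h1 := H'.mem_algD hr (by omega) hB
    refine L'.succ ?_
    rw [(L (l + 1) hl).line l (Nat.lt_succ_self l)] at h1 ⊢
    exact span_singleton_eq_of_mem h1 (H'.colMap_ne_zero (by omega) _ _)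

theorem LinesBelow.algH_eq {c : Fin (s + 1) → K} (L : LinesBelow F k c h D s) :
    algH F k (s + 1) D =
      (⨆ j ∈ Finset.range s, Submodule.span K {colMap F h 0 (frobVec F (-j - s) c)}) ⊔
        Submodule.span K {colMap F h 0 (frobVec F (1 - (n - k : ℕ)) c)} := by
  unfold algH
  rw [Nat.add_sub_cancel, L.last, twist_span_colMap]
  have h1 : 2 * (s : ℤ) - 1 + (2 - (((s + 1 : ℕ) : ℤ) - 1) - (s + 1 : ℕ)) = 0 := by omega
  have h2 : 2 - (((s + 1 : ℕ) : ℤ) - 1) - (s + 1 : ℕ) + (2 * s - (n - k : ℕ)) =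
    1 - (n - k : ℕ) := by omega
  rw [h1, h2]
  congr 1
  refine iSup_congr fun j => iSup_congr fun hj => ?_
  rw [L.line j (Finset.mem_range.1 hj), twist_span_colMap]
  have h3 : (s : ℤ) - 1 + j + (2 - j - (s + 1 : ℕ)) = 0 := by omega
  have h4 : 2 - (j : ℤ) - (s + 1 : ℕ) + -1 = -j - s := by omega
  rw [h3, h4]

theorem LinesBelow.algH_le {c : Fin (s + 1) → K} (L : LinesBelow F k c h D s) :
    algH F k (s + 1) D ≤ LinearMap.range (colMap F h 0) := by
  rw [L.algH_eq]
  refine sup_le (iSup₂_le fun j _ => ?_) ?_ <;>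
    exact (Submodule.span_singleton_le_iff_mem _ _).2 (LinearMap.mem_range_self _ _)

theorem LinesBelow.le_algH {c : Fin (s + 1) → K} (L : LinesBelow F k c h D s)
    (hc : PowersSpan F (n - k) c) (hr : 2 * (s + 1) ≤ n - k) :
    LinearMap.range (colMap F h 0) ≤ algH F k (s + 1) D := by
  classical
  rw [L.algH_eq, LinearMap.range_le_iff_comap, eq_top_iff]
  -- The `D_j` reach column `0` in the rows `-s - j`, `j < s`, and `D_{λ-1}` in row `1 - r`: `s + 1`
  -- rows in a window of length `r`.
  rw [← hc (insert (1 - (n - k : ℕ) : ℤ) (Finset.Icc (1 - 2 * s : ℤ) (-s))) (1 - (n - k : ℕ))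
    (by
      rw [Finset.card_insert_of_notMem (by rw [Finset.mem_Icc]; omega), Int.card_Icc]
      omega)
    (by
      intro t ht
      rw [Finset.mem_insert, Finset.mem_Icc] at ht
      omega), Submodule.span_le]
  rintro _ ⟨t, ht, rfl⟩
  rw [Finset.mem_coe, Finset.mem_insert, Finset.mem_Icc] at ht
  rcases ht with rfl | ht
  · exact Submodule.mem_sup_right (Submodule.mem_span_singleton_self _)
  · refine Submodule.mem_sup_left (Submodule.mem_iSup_of_mem (-t - s).toNat
      (Submodule.mem_iSup_of_mem (Finset.mem_range.2 (by omega)) ?_))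
    have h1 : -((-t - s).toNat : ℤ) - s = t := by omega
    rw [h1]
    exact Submodule.mem_span_singleton_self _

theorem Generic.algOutput_le {c : Fin (s + 1) → K} (H : Generic F c (n - k) h D)
    (hr : 2 * (s + 1) ≤ n - k) (L : LinesBelow F k c h D s) {i : ℕ} (hi : i < n - k) :
    algOutput F k (s + 1) D i ≤ Submodule.span K {colMap F h 0 (frobVec F (-i) c)} := by
  have h1 : LinearMap.range (colMap F h 0) ≤
      ofColumns F h fun j => if j = 0 then ⊤ else ⊥ := by
    rintro _ ⟨v, rfl⟩
    exact colMap_mem_ofColumns F h (by simp)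
  refine (inf_le_inf_right _ (L.algH_le.trans h1)).trans ?_
  -- This `u` makes column `0` full, its rows starting at `1 - r` or later, while keeping row `-i`
  -- within `u..u+s+1`.
  refine H.inf_twist_le (u := max (1 - (n - k : ℕ)) (-i - s)) (by omega) (by omega)
    (fun j => ?_) fun j _ _ hj => ?_
  · split_ifs with hj
    · rw [sumColumn, powSpan_eq_top H.powSpan_top (by omega)]
    · exact bot_le
  · rw [if_neg hj, Submodule.mem_bot]
    intro h0
    have h2 := frobVec_eq_zero F h0
    have h3 := H.powSpan_top
    rw [eq_top_iff] at h3
    have h4 : powSpan F c 0 s ≤ ⊥ := powSpan_le F fun t _ _ => by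
      rw [h2, frobVec_zero]
      exact zero_mem _
    exact absurd (le_bot_iff.1 (h3.trans h4)) top_ne_bot

theorem Generic.algOutput_eq (H : Generic F (withOne β) (n - k) h D)
    (hβ : PowersSpan F (n - k) (withOne β)) (H' : Generic F (withOne β') (n - k) h' D)
    (hs : 1 ≤ s) (hr : 2 * (s + 1) ≤ n - k) {i : ℕ} (hi : i < n - k) :
    algOutput F k (s + 1) D i =
      Submodule.span K {colMap F h' 0 (frobVec F (-i) (withOne β'))} := by
  have L := H.linesBelow hβ hs hr s le_rfl
  have L' := H.linesBelow_of_generic hβ H' hs hr s le_rfl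
  -- Both solutions have an injective `colMap` at `0`, so the span of the `h'_b` has the dimension
  -- `s + 1` of `H`.
  have hH : algH F k (s + 1) D = LinearMap.range (colMap F h' 0) := by
    refine Submodule.eq_of_le_of_finrank_eq L'.algH_le ?_
    rw [le_antisymm L.algH_le (L.le_algH hβ hr),
      LinearMap.finrank_range_of_inj (H.colMap_injective (by omega) 0),
      LinearMap.finrank_range_of_inj (H'.colMap_injective (by omega) 0)]
  have hmem : colMap F h' 0 (frobVec F (-i) (withOne β')) ∈ algOutput F k (s + 1) D i := by
    refine ⟨?_, H'.colMap_mem_twist (by omega) (by omega)⟩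
    rw [hH]
    exact LinearMap.mem_range_self _ _
  refine le_antisymm ?_ ((Submodule.span_singleton_le_iff_mem _ _).2 hmem)
  have hle := H.algOutput_le hr L hi
  rw [← span_singleton_eq_of_mem (hle hmem) (H'.colMap_ne_zero (by omega) _ _)]
  exact hle

end Recovery

end

end Loidreau

theorem mainTheorem1
    {F K : Type*} [Field F] [Fintype F] [Field K] [Finite K] [Algebra F K]
    (n k s : ℕ) (Cpub : Submodule K (Fin n → K))
    (hk : Module.finrank K Cpub = k)
    -- Here `λ = s + 1`, so `λ ≥ 2`, `λ ≤ n / (n - k + 1)` and `λ ≤ (n - k) / 2`.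
    (hs : 2 ≤ s + 1)
    (hrate : (s + 1) * (n - k + 1) ≤ n)
    (hlam : 2 * (s + 1) ≤ n - k)
    -- Assumptions (1) and (3)
    (h13 : ∃ p ∈ Loidreau.solutionSet F s (n - k) (Loidreau.dualCode Cpub),
      Loidreau.MooreNondegenerate F (n - k) p.2 ∧ Loidreau.TrivialStabilizer F p.2)
    -- Assumption (2)
    (h2 : Module.finrank K
        (⨆ i ∈ Finset.range (s + 2),
          Loidreau.twist F (i : ℤ) (Loidreau.dualCode Cpub) : Submodule K (Fin n → K)) =
      (s + 1) * (n - k) + (s + 1)) :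
    ∀ p ∈ Loidreau.solutionSet F s (n - k) (Loidreau.dualCode Cpub), ∀ i : ℕ, i < n - k →
      Loidreau.algOutput F k (s + 1) (Loidreau.dualCode Cpub) i =
          Submodule.span K
            {p.1 0 + ∑ j : Fin s, Loidreau.frob F (-(i : ℤ)) (p.2 j) • p.1 j.succ} ∧
        Module.finrank K (Loidreau.algOutput F k (s + 1) (Loidreau.dualCode Cpub) i) = 1 := by
  intro p hp i hi
  obtain ⟨q, hq, hmoore, -⟩ := h13
  have H := Loidreau.generic_of_finrank (by omega) hq.1 h2
  have H' := Loidreau.generic_of_finrank (by omega) hp.1 h2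
  have key := H.algOutput_eq hmoore.powersSpan H' (by omega) hlam hi
  refine ⟨?_, ?_⟩
  · rw [key, ← Loidreau.yVec_eq_colMap]
    simp only [Loidreau.yVec, Loidreau.frobVec_zero_exp]
  · rw [key]
    exact finrank_span_singleton (H'.colMap_ne_zero (by omega) _ _)
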